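/- Let $\Omega\subset\mathbb{R}^2$ and let $\mathcal{T}_h$ be a conforming mesh of $\overline\Omega$ by finitely many closed non-degenerate triangles: the triangles cover $\overline\Omega$, do not overlap, and any two of them meet in the convex hull of their common vertices. Write $h_K$ for the diameter of $K\in\mathcal{T}_h$ and $h:=\max_{K\in\mathcal{T}_h}h_K$ for the mesh size. Assume that $\mathcal{T}_h$ is shape regular with constant $\sigma$, i.e. every $K\in\mathcal{T}_h$ contains a disc of diameter $\rho_K>0$ with $h_K\le\sigma\rho_K$. Let $V_h$ be the space of continuous functions on $\overline\Omega$ that are affine on every $K\in\mathcal{T}_h$. For a function $f$ that is continuous on the closed triangle $K$, let $i_hf$ denote its Lagrange nodal interpolant on $K$, i.e. the affine function that agrees with $f$ at the three vertices of $K$. Write $\|\cdot\|_K$ for the norm of $L^2(K)$ and $|\varphi|_{W^{1,\infty}(K)}:=\|\nabla\varphi\|_{L^\infty(K)}$, where gradients are weak gradients in the interior of $K$. Then there is a constant $C>0$ that depends only on $\sigma$ (in particular, neither on $h$ nor on $\Omega$, $\mathcal{T}_h$, $K$, $v_h$, $\varphi$) such that for all $v_h\in V_h$, all $K\in\mathcal{T}_h$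 and every weight function $\varphi\in W^{1,\infty}(K)$, the following holds. The function $\varphi$ has a representative that is continuous on the closed triangle $K$; with $\varphi$ identified with this representative, $v_h\varphi-i_h(v_h\varphi)\in H^1(K)$ and $$\|v_h\varphi-i_h(v_h\varphi)\|_K+h\,\|\nabla(v_h\varphi-i_h(v_h\varphi))\|_K\le C\,h\,|\varphi|_{W^{1,\infty}(K)}\,\|v_h\|_K .$$ -/

import Mathlib

open MeasureTheory Set
open scoped ENNReal ContDiff

namespace FEM

/-- The Euclidean plane. -/
abbrev Plane : Type := EuclideanSpace ℝ (Fin 2)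

/-! ### Sobolev spaces of first order through weak derivatives -/

/-- `g` is a weak (distributional) gradient of `u` on the open set `U`:
`∫_U u ∂_e ψ = - ∫_U (g · e) ψ` for all directions `e` and all `ψ ∈ C_c^∞(U)`. -/
structure IsWeakGradient (U : Set Plane) (u : Plane → ℝ) (g : Plane → Plane) : Prop where
  locallyIntegrableOn : LocallyIntegrableOn u U volume
  locallyIntegrableOn_grad : LocallyIntegrableOn g U volume
  integral_eq : ∀ ψ : Plane → ℝ, ContDiff ℝ ∞ ψ → HasCompactSupport ψ → tsupport ψ ⊆ U →
    ∀ e : Plane, ∫ x in U, u x * fderiv ℝ ψ x e = - ∫ x in U, inner ℝ (g x) e * ψ x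

/-- `u ∈ W^{1,p}(U)`: `u` lies in `L^p(U)` and has a weak gradient in `L^p(U)`. -/
def MemW1 (p : ℝ≥0∞) (U : Set Plane) (u : Plane → ℝ) : Prop :=
  MemLp u p (volume.restrict U) ∧
    ∃ g : Plane → Plane, IsWeakGradient U u g ∧ MemLp g p (volume.restrict U)

open Classical in
/-- The weak gradient `∇u` on the open set `U` (and `0` if `u` has none); it is determined
up to a null set, see `IsWeakGradient.ae_eq`. -/
noncomputable def weakGrad (U : Set Plane) (u : Plane → ℝ) : Plane → Plane :=
  if h : ∃ g : Plane → Plane, IsWeakGradient U u g then h.choose else 0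

/-- The norm of `L^p(U)` of a scalar or vector field; vectors carry the Euclidean norm.
(It is only used for functions that are in `L^p(U)`.) -/
noncomputable def lpNormOn {F : Type*} [NormedAddCommGroup F] (p : ℝ≥0∞) (U : Set Plane)
    (f : Plane → F) : ℝ :=
  (eLpNorm f p (volume.restrict U)).toReal

/-- The seminorm `|u|_{W^{1,∞}(U)} = ‖∇u‖_{L^∞(U)}`. -/
noncomputable def seminormW1Infty (U : Set Plane) (u : Plane → ℝ) : ℝ :=
  lpNormOn ∞ U (weakGrad U u)

/-- Weak gradients are unique almost everywhere. -/
theorem IsWeakGradient.ae_eq {U : Set Plane} (hU : IsOpen U) {u : Plane → ℝ}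
    {g g' : Plane → Plane} (h : IsWeakGradient U u g) (h' : IsWeakGradient U u g') :
    g =ᵐ[volume.restrict U] g' := by
  have key : ∀ᵐ x ∂(volume : Measure Plane), x ∈ U → (g - g') x = 0 := by
    refine hU.ae_eq_zero_of_integral_contDiff_smul_eq_zero
      (h.locallyIntegrableOn_grad.sub h'.locallyIntegrableOn_grad) ?_
    intro ψ hψ hc hs
    have int : ∀ f : Plane → Plane, LocallyIntegrableOn f U volume →
        Integrable (fun x => ψ x • f x) volume := by
      intro f hf
      have h1 : IntegrableOn f (tsupport ψ) volume :=
        hf.integrableOn_compact_subset hs hc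
      have h2 : IntegrableOn (fun x => ψ x • f x) (tsupport ψ) volume :=
        h1.continuousOn_smul hψ.continuous.continuousOn hc
      refine (integrableOn_iff_integrable_of_support_subset ?_).1 h2
      intro x hx
      apply subset_tsupport
      intro h0
      exact hx (by simp [h0])
    have i1 := int g h.locallyIntegrableOn_grad
    have i2 := int g' h'.locallyIntegrableOn_grad
    have inn : ∀ (f : Plane → Plane) (_ : Integrable (fun x => ψ x • f x) volume) (e : Plane),
        inner ℝ e (∫ x, ψ x • f x) = ∫ x in U, inner ℝ (f x) e * ψ x := by
      intro f hf e
      rw [← integral_inner hf e, setIntegral_eq_integral_of_forall_compl_eq_zero]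
      · refine integral_congr_ae (Filter.Eventually.of_forall fun x => ?_)
        simp only [inner_smul_right, real_inner_comm e (f x)]
        ring
      · intro x hx
        rw [image_eq_zero_of_notMem_tsupport (fun hx' => hx (hs hx')), mul_zero]
    have : (∫ x, ψ x • g x) = ∫ x, ψ x • g' x := by
      refine ext_inner_left ℝ fun e => ?_
      rw [inn g i1 e, inn g' i2 e]
      have a := h.integral_eq ψ hψ hc hs e
      have b := h'.integral_eq ψ hψ hc hs e
      linarith
    simp only [Pi.sub_apply, smul_sub]
    rw [integral_sub i1 i2, this, sub_self]
  rw [Filter.EventuallyEq, ae_restrict_iff' hU.measurableSet]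
  filter_upwards [key] with x hx hxU
  exact sub_eq_zero.1 (hx hxU)

/-! ### Triangular meshes and piecewise affine functions -/

/-- The vertices of a non-degenerate triangle of the plane form an affine basis. -/
noncomputable def triangleBasis (K : Affine.Triangle ℝ Plane) : AffineBasis (Fin 3) ℝ Plane where
  toFun := K.points
  ind' := K.independent
  tot' := by
    rw [K.independent.affineSpan_eq_top_iff_card_eq_finrank_add_one]
    simp

/-- The Lagrange nodal interpolant of `f` on the triangle `K`: the affine function
`∑ i, f (a_i) λ_i` with the vertices `a_i` and the barycentric coordinates `λ_i` of `K`. -/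
noncomputable def lagrangeInterp (K : Affine.Triangle ℝ Plane) (f : Plane → ℝ) : Plane → ℝ :=
  fun x => ∑ i : Fin 3, f (K.points i) * (triangleBasis K).coord i x

/-- A conforming triangular mesh of `Ω ⊆ ℝ²`: finitely many closed triangles that cover the closure
of `Ω`; different elements do not overlap, and they meet in a common face (an edge, a vertex or
nothing), that is, in the convex hull of their common vertices. -/
structure TriMesh (Ω : Set Plane) where
  elems : Finset (Affine.Triangle ℝ Plane)
  iUnion_eq : ⋃ K ∈ elems, K.closedInterior = closure Ω
  disjoint_interior : ∀ K ∈ elems, ∀ K' ∈ elems, K ≠ K' →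
    Disjoint (interior K.closedInterior) (interior K'.closedInterior)
  inter_eq : ∀ K ∈ elems, ∀ K' ∈ elems, K.closedInterior ∩ K'.closedInterior =
    convexHull ℝ (range K.points ∩ range K'.points)

/-- The mesh size `h = max_K h_K`, where `h_K` is the diameter of the element `K`. -/
noncomputable def TriMesh.meshSize {Ω : Set Plane} (T : TriMesh Ω) : ℝ :=
  ⨆ K : T.elems, Metric.diam (K : Affine.Triangle ℝ Plane).closedInterior

/-- Shape regularity with constant `σ`: every element `K` contains a disc of diameter `2 r` with
`h_K ≤ σ (2 r)`, that is, `h_K / ρ_K ≤ σ` for the diameter `ρ_K` of the inscribed disc. -/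
def TriMesh.IsShapeRegular {Ω : Set Plane} (T : TriMesh Ω) (σ : ℝ) : Prop :=
  ∀ K ∈ T.elems, ∃ (c : Plane) (r : ℝ), 0 < r ∧ Metric.closedBall c r ⊆ K.closedInterior ∧
    Metric.diam K.closedInterior ≤ σ * (2 * r)

/-- `v ∈ V_h`: `v` is continuous on the closure of `Ω` and affine on every element. -/
def TriMesh.MemP1 {Ω : Set Plane} (T : TriMesh Ω) (v : Plane → ℝ) : Prop :=
  ContinuousOn v (closure Ω) ∧
    ∀ K ∈ T.elems, ∃ a : Plane →ᴬ[ℝ] ℝ, EqOn v a K.closedInterior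

end FEM

/-! On `K` the function `v` is affine, say `a`; let `M = max_K |a|`, `d = h_K`, and let `L` be the
seminorm of `φ`. Interpolation reproduces affine functions, so a constant can be subtracted from `φ`
for free: if `m` is a nodal value of `φ`, the error is `a (φ - m) - b`, with `b` the nodal
interpolant of `a (φ - m)`.

As the interior of `K` is convex, `φ` has an `L`-Lipschitz representative
(`IsWeakGradient.exists_lipschitzWith`). Hence `|φ - m| ≤ L d`, and the error is at most `2 M L d`.
Its gradient is `a ∇φ + (φ - m) ∇a - ∇b`. The inscribed disc of radius `r` bounds the slopes of `a`
and `b` by `M / r` and `M L d / r` (`norm_affineGrad_le`), and shape regularity `d ≤ 2 σ r` turns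
this into the bound `(1 + 4 σ) M L`.

These pointwise bounds become `L²` bounds through `M |K|^{1/2} ≤ 8 ‖v‖_K` (`mul_sqrt_le_lpNormOn`).
No power of `d` is left in the gradient bound, so it can be multiplied by the global `h`. -/

namespace FEM

/-! ### Calculus of weak gradients -/

/-- The product of a locally integrable function on `U` and a continuous
function with compact support in `U` is integrable. -/
theorem integrable_mul_of_tsupport_subset {U : Set Plane} {f η : Plane → ℝ}
    (hf : LocallyIntegrableOn f U volume) (hη : Continuous η) (hc : HasCompactSupport η)
    (hs : tsupport η ⊆ U) : Integrable (fun x => f x * η x) volume := by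
  have h1 : IntegrableOn f (tsupport η) volume := hf.integrableOn_compact_subset hs hc
  have h2 : IntegrableOn (fun x => f x * η x) (tsupport η) volume :=
    h1.mul_continuousOn hη.continuousOn hc
  refine (integrableOn_iff_integrable_of_support_subset ?_).1 h2
  intro x hx
  apply subset_tsupport
  intro h0
  exact hx (by simp [h0])

theorem LocallyIntegrableOn.inner_const {U : Set Plane} {g : Plane → Plane}
    (hg : LocallyIntegrableOn g U volume) (e : Plane) :
    LocallyIntegrableOn (fun x => inner ℝ (g x) e) U volume := fun x hx => by
  obtain ⟨s, hs, hi⟩ := hg x hx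
  exact ⟨s, hs, Integrable.inner_const hi e⟩

/-- The gradient of an affine function. -/
noncomputable def affineGrad (a : Plane →ᴬ[ℝ] ℝ) : Plane :=
  (InnerProductSpace.toDual ℝ Plane).symm a.contLinear

theorem inner_affineGrad (a : Plane →ᴬ[ℝ] ℝ) (e : Plane) :
    inner ℝ (affineGrad a) e = a.contLinear e := by
  simp [affineGrad]

theorem norm_affineGrad (a : Plane →ᴬ[ℝ] ℝ) : ‖affineGrad a‖ = ‖a.contLinear‖ := by
  simp [affineGrad]

theorem hasFDerivAt_affine (a : Plane →ᴬ[ℝ] ℝ) (x : Plane) :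
    HasFDerivAt a a.contLinear x := by
  have h : (a : Plane → ℝ) = fun y => a.contLinear y + a 0 := by
    rw [a.decomp]; ext y; simp
  rw [h]
  exact a.contLinear.hasFDerivAt.add_const _

theorem contDiff_affine (a : Plane →ᴬ[ℝ] ℝ) : ContDiff ℝ ∞ a := by
  have h : (a : Plane → ℝ) = fun y => a.contLinear y + a 0 := by
    rw [a.decomp]; ext y; simp
  rw [h]
  exact a.contLinear.contDiff.add contDiff_const

theorem IsWeakGradient.congr_ae {U : Set Plane} (hU : IsOpen U) {u u' : Plane → ℝ}
    {g : Plane → Plane} (h : IsWeakGradient U u g) (hu : u =ᵐ[volume.restrict U] u') :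
    IsWeakGradient U u' g where
  locallyIntegrableOn := by
    have h1 := h.locallyIntegrableOn
    rw [locallyIntegrableOn_iff hU.isLocallyClosed] at h1 ⊢
    intro k hk hc
    exact (h1 k hk hc).congr (ae_restrict_of_ae_restrict_of_subset hk hu)
  locallyIntegrableOn_grad := h.locallyIntegrableOn_grad
  integral_eq ψ hψ hc hs e := by
    rw [← h.integral_eq ψ hψ hc hs e]
    refine integral_congr_ae ?_
    filter_upwards [hu] with x hx
    rw [hx]

theorem IsWeakGradient.sub {U : Set Plane} {u u' : Plane → ℝ} {g g' : Plane → Plane}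
    (h : IsWeakGradient U u g) (h' : IsWeakGradient U u' g') :
    IsWeakGradient U (fun x => u x - u' x) (fun x => g x - g' x) where
  locallyIntegrableOn := h.locallyIntegrableOn.sub h'.locallyIntegrableOn
  locallyIntegrableOn_grad := h.locallyIntegrableOn_grad.sub h'.locallyIntegrableOn_grad
  integral_eq ψ hψ hc hs e := by
    have cd : Continuous fun x => fderiv ℝ ψ x e :=
      (hψ.continuous_fderiv (by simp)).clm_apply continuous_const
    have sd : tsupport (fun x => fderiv ℝ ψ x e) ⊆ tsupport ψ :=
      tsupport_fderiv_apply_subset ℝ e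
    have i1 := fun {f : Plane → ℝ} (hf : LocallyIntegrableOn f U volume) =>
      (integrable_mul_of_tsupport_subset hf cd (hc.fderiv_apply ℝ e) (sd.trans hs)).restrict (s := U)
    have i2 := fun {f : Plane → ℝ} (hf : LocallyIntegrableOn f U volume) =>
      (integrable_mul_of_tsupport_subset hf hψ.continuous hc hs).restrict (s := U)
    simp only [inner_sub_left, sub_mul]
    rw [integral_sub (i1 h.locallyIntegrableOn) (i1 h'.locallyIntegrableOn),
      integral_sub (i2 (LocallyIntegrableOn.inner_const h.locallyIntegrableOn_grad e))
        (i2 (LocallyIntegrableOn.inner_const h'.locallyIntegrableOn_grad e)),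
      h.integral_eq ψ hψ hc hs e, h'.integral_eq ψ hψ hc hs e]
    ring

/-- Together with `IsWeakGradient.affine_mul` this yields the weak gradient of every affine
function, in particular of the interpolant. -/
theorem isWeakGradient_one (U : Set Plane) : IsWeakGradient U (fun _ => 1) (fun _ => 0) where
  locallyIntegrableOn := (locallyIntegrable_const 1).locallyIntegrableOn U
  locallyIntegrableOn_grad := (locallyIntegrable_const 0).locallyIntegrableOn U
  integral_eq ψ hψ hc hs e := by
    have cd : Continuous fun x => fderiv ℝ ψ x e :=
      (hψ.continuous_fderiv (by simp)).clm_apply continuous_const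
    have sd : tsupport (fun x => fderiv ℝ ψ x e) ⊆ tsupport ψ :=
      tsupport_fderiv_apply_subset ℝ e
    rw [setIntegral_eq_integral_of_forall_compl_eq_zero]
    · have := integral_mul_fderiv_eq_neg_fderiv_mul_of_integrable (μ := (volume : Measure Plane))
        (f := fun _ : Plane => (1 : ℝ)) (g := ψ) (v := e) (by simp)
        (by simpa using cd.integrable_of_hasCompactSupport (hc.fderiv_apply ℝ e))
        (by simpa using hψ.continuous.integrable_of_hasCompactSupport hc)
        (fun x _ => differentiableAt_const _)
        (fun x _ => hψ.differentiable (by simp) x)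
      simpa using this
    · intro x hx
      rw [image_eq_zero_of_notMem_tsupport (f := fun x => fderiv ℝ ψ x e)
        (fun h => hx (hs (sd h))), mul_zero]

/-- The product rule for an affine factor. -/
theorem IsWeakGradient.affine_mul {U : Set Plane} (hU : IsOpen U) {u : Plane → ℝ}
    {g : Plane → Plane} (h : IsWeakGradient U u g) (a : Plane →ᴬ[ℝ] ℝ) :
    IsWeakGradient U (fun x => a x * u x) (fun x => a x • g x + u x • affineGrad a) where
  locallyIntegrableOn :=
    h.locallyIntegrableOn.continuousOn_mul a.continuous.continuousOn hU.isLocallyClosed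
  locallyIntegrableOn_grad :=
    (h.locallyIntegrableOn_grad.continuousOn_smul hU.isLocallyClosed a.continuous.continuousOn).add
      (h.locallyIntegrableOn.smul_continuousOn hU.isLocallyClosed continuousOn_const)
  integral_eq ψ hψ hc hs e := by
    have cd : Continuous fun x => fderiv ℝ ψ x e :=
      (hψ.continuous_fderiv (by simp)).clm_apply continuous_const
    have sd : tsupport (fun x => fderiv ℝ ψ x e) ⊆ tsupport ψ :=
      tsupport_fderiv_apply_subset ℝ e
    -- The affine factor is moved into the test function: `a ψ` is again admissible, and its
    -- derivative produces the extra term with the slope of `a`.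
    have hψ' : ContDiff ℝ ∞ fun x => a x * ψ x := (contDiff_affine a).mul hψ
    have hc' : HasCompactSupport fun x => a x * ψ x := hc.mul_left
    have hs' : tsupport (fun x => a x * ψ x) ⊆ U := (tsupport_mul_subset_right).trans hs
    have key := h.integral_eq _ hψ' hc' hs' e
    have hd : ∀ x, fderiv ℝ (fun x => a x * ψ x) x e
        = a x * fderiv ℝ ψ x e + ψ x * a.contLinear e := fun x => by
      have := ((hasFDerivAt_affine a x).mul (hψ.differentiable (by simp) x).hasFDerivAt).fderiv
      rw [show (fun x => a x * ψ x) = a * ψ from rfl, this]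
      simp
    have i1 : Integrable (fun x => u x * (a x * fderiv ℝ ψ x e)) volume :=
      integrable_mul_of_tsupport_subset h.locallyIntegrableOn (a.continuous.mul cd)
        (hc.fderiv_apply ℝ e).mul_left (tsupport_mul_subset_right.trans (sd.trans hs))
    have i2 : Integrable (fun x => u x * (ψ x * a.contLinear e)) volume :=
      integrable_mul_of_tsupport_subset h.locallyIntegrableOn (hψ.continuous.mul continuous_const)
        hc.mul_right (tsupport_mul_subset_left.trans hs)
    have i3 : Integrable (fun x => inner ℝ (g x) e * (a x * ψ x)) volume :=
      integrable_mul_of_tsupport_subset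
        (LocallyIntegrableOn.inner_const h.locallyIntegrableOn_grad e) hψ'.continuous hc' hs'
    simp only [hd, mul_add] at key
    rw [integral_add i1.restrict i2.restrict] at key
    have e1 : ∀ x, inner ℝ (a x • g x + u x • affineGrad a) e * ψ x
        = inner ℝ (g x) e * (a x * ψ x) + u x * (ψ x * a.contLinear e) := fun x => by
      rw [inner_add_left, real_inner_smul_left, real_inner_smul_left, inner_affineGrad]
      ring
    simp only [e1]
    rw [integral_add i3.restrict i2.restrict]
    have e2 : ∀ x, a x * u x * fderiv ℝ ψ x e = u x * (a x * fderiv ℝ ψ x e) := fun x => by ring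
    simp only [e2]
    linarith

/-! ### Lipschitz representatives by mollification -/

/-- Mollification does not increase the bound of a weak gradient. -/
theorem IsWeakGradient.exists_hasFDerivAt_mollification {U : Set Plane} (hU : IsOpen U)
    {u : Plane → ℝ}
    {g : Plane → Plane} (h : IsWeakGradient U u g) (hu : LocallyIntegrable (U.indicator u) volume)
    {L : ℝ} (hL : ∀ᵐ x ∂volume.restrict U, ‖g x‖ ≤ L) (φ : ContDiffBump (0 : Plane))
    {x : Plane} (hx : Metric.closedBall x φ.rOut ⊆ U) :
    ∃ D : Plane →L[ℝ] ℝ, ‖D‖ ≤ L ∧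
      HasFDerivAt (convolution (φ.normed volume) (U.indicator u)
        (ContinuousLinearMap.lsmul ℝ ℝ) volume) D x := by
  set ρ := φ.normed (volume : Measure Plane) with hρdef
  have hρ : ContDiff ℝ ∞ ρ := φ.contDiff_normed
  have hρc : HasCompactSupport ρ := φ.hasCompactSupport_normed
  have hL0 : 0 ≤ L := by
    have hne : (volume.restrict U) ≠ 0 := by
      rw [Ne, Measure.restrict_eq_zero]
      exact (hU.measure_pos volume ⟨x, hx (Metric.mem_closedBall_self φ.rOut_pos.le)⟩).ne'
    have : (ae (volume.restrict U)).NeBot := ae_neBot.2 hne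
    obtain ⟨y, hy⟩ := hL.exists
    exact (norm_nonneg _).trans hy
  have hd := hρc.hasFDerivAt_convolution_right (ContinuousLinearMap.lsmul ℝ ℝ).flip hu
    (hρ.of_le (by simp)) x
  rw [convolution_flip] at hd
  refine ⟨_, ContinuousLinearMap.opNorm_le_bound _ hL0 fun e => ?_, hd⟩
  rw [convolution_precompR_apply _ hu (hρc.fderiv ℝ) (hρ.continuous_fderiv (by simp))]
  -- The reflected kernel is a test function supported in `U`. The sign from the reflection cancels
  -- the one in the definition of a weak gradient, so the derivative of the mollification is an
  -- average of `g` against a kernel of mass one.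
  let ψ : Plane → ℝ := fun t => ρ (x - t)
  have hψ : ContDiff ℝ ∞ ψ := hρ.comp (contDiff_const.sub contDiff_id)
  have hsub : tsupport ψ ⊆ Metric.closedBall x φ.rOut := by
    refine closure_minimal (fun t ht => ?_) Metric.isClosed_closedBall
    have h1 : x - t ∈ Function.support ρ := ht
    rw [φ.support_normed_eq] at h1
    rw [Metric.mem_closedBall, dist_comm, dist_eq_norm]
    exact (mem_ball_zero_iff.1 h1).le
  have hψc : HasCompactSupport ψ :=
    (isCompact_closedBall x φ.rOut).of_isClosed_subset (isClosed_tsupport ψ) hsub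
  have hder : ∀ t, fderiv ℝ ψ t e = - fderiv ℝ ρ (x - t) e := fun t => by
    have h1 : HasFDerivAt (fun t : Plane => x - t) (-(ContinuousLinearMap.id ℝ Plane)) t :=
      (hasFDerivAt_id t).const_sub x
    have h2 := ((hρ.differentiable (by simp) (x - t)).hasFDerivAt.comp t h1).fderiv
    rw [show ψ = ρ ∘ fun t => x - t from rfl, h2]
    simp
  have key := h.integral_eq ψ hψ hψc (hsub.trans hx) e
  have hconv : convolution (U.indicator u) (fun a => fderiv ℝ ρ a e)
      (ContinuousLinearMap.lsmul ℝ ℝ).flip volume x = ∫ t in U, inner ℝ (g t) e * ψ t := by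
    rw [← neg_eq_iff_eq_neg] at key
    rw [← key, ← integral_neg, ← integral_indicator hU.measurableSet]
    refine integral_congr_ae (Filter.Eventually.of_forall fun t => ?_)
    by_cases ht : t ∈ U
    · simp [ht, hder, mul_comm]
    · simp [ht]
  rw [hconv]
  have hψ0 : ∀ t, 0 ≤ ψ t := fun t => φ.nonneg_normed _
  have hψi : Integrable ψ volume := hψ.continuous.integrable_of_hasCompactSupport hψc
  have hint : ∫ t, ψ t = 1 := by
    rw [integral_sub_left_eq_self (fun t => ρ t) volume x]
    exact φ.integral_normed
  calc ‖∫ t in U, inner ℝ (g t) e * ψ t‖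
      ≤ ∫ t in U, (L * ‖e‖) * ψ t := by
        refine norm_integral_le_of_norm_le (hψi.restrict.const_mul _) ?_
        filter_upwards [hL] with t ht
        rw [norm_mul, Real.norm_of_nonneg (hψ0 t)]
        gcongr
        · exact hψ0 t
        · exact (norm_inner_le_norm _ _).trans (by gcongr)
    _ = (L * ‖e‖) * ∫ t in U, ψ t := integral_const_mul _ _
    _ ≤ (L * ‖e‖) * ∫ t, ψ t := by
        gcongr
        · exact Filter.Eventually.of_forall hψ0
        · exact Measure.restrict_le_self
    _ = L * ‖e‖ := by rw [hint, mul_one]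

/-- A function with a bounded weak gradient on a convex open set has a Lipschitz continuous
representative. -/
theorem IsWeakGradient.exists_lipschitzWith {U : Set Plane} (hU : IsOpen U) (hconv : Convex ℝ U)
    {u : Plane → ℝ} {g : Plane → Plane} (h : IsWeakGradient U u g)
    (hu : LocallyIntegrable (U.indicator u) volume)
    {L : NNReal} (hL : ∀ᵐ x ∂volume.restrict U, ‖g x‖ ≤ L) :
    ∃ w : Plane → ℝ, LipschitzWith L w ∧ u =ᵐ[volume.restrict U] w := by
  -- The fixed ratio 2 of outer to inner radius is what the almost everywhere convergence below
  -- requires.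
  let φ : ℕ → ContDiffBump (0 : Plane) := fun n =>
    ⟨1 / (2 * ((n : ℝ) + 1)), 1 / ((n : ℝ) + 1), by positivity, by
      apply one_div_lt_one_div_of_lt <;> linarith [(Nat.cast_nonneg n : (0 : ℝ) ≤ n)]⟩
  have hφ : Filter.Tendsto (fun n => (φ n).rOut) Filter.atTop (nhds 0) :=
    tendsto_one_div_add_atTop_nhds_zero_nat
  have hae := ContDiffBump.ae_convolution_tendsto_right_of_locallyIntegrable (K := 2) hφ
    (Filter.Eventually.of_forall fun n => by
      change 1 / ((n : ℝ) + 1) ≤ 2 * (1 / (2 * ((n : ℝ) + 1)))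
      apply le_of_eq; field_simp) hu
  let S : Set Plane := {x | x ∈ U ∧ Filter.Tendsto (fun n => convolution ((φ n).normed volume)
    (U.indicator u) (ContinuousLinearMap.lsmul ℝ ℝ) volume x) Filter.atTop (nhds (u x))}
  have hS : LipschitzOnWith L u S := by
    refine LipschitzOnWith.of_dist_le_mul fun x hx y hy => ?_
    have hseg : segment ℝ x y ⊆ U := hconv.segment_subset hx.1 hy.1
    have hcomp : IsCompact (segment ℝ x y) := by
      rw [← convexHull_pair]
      exact (toFinite {x, y}).isCompact_convexHull ℝ
    -- Once the mollification radius is below `δ`, the derivative bound holds along the whole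
    -- segment; the mean value inequality then passes to the limit.
    obtain ⟨δ, hδ, hδU⟩ := hcomp.exists_cthickening_subset_open hU hseg
    have hlim := (hx.2.dist hy.2)
    refine le_of_tendsto hlim ?_
    filter_upwards [hφ.eventually_lt_const hδ] with n hn
    have hball : ∀ z ∈ segment ℝ x y, Metric.closedBall z (φ n).rOut ⊆ U := fun z hz =>
      (Metric.closedBall_subset_closedBall hn.le).trans
        ((Metric.closedBall_subset_cthickening hz δ).trans hδU)
    have hD := fun z (hz : z ∈ segment ℝ x y) => h.exists_hasFDerivAt_mollification hU hu hL (φ n) (hball z hz)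
    choose! D hD1 hD2 using hD
    have := Convex.norm_image_sub_le_of_norm_hasFDerivWithin_le (𝕜 := ℝ)
      (fun z hz => (hD2 z hz).hasFDerivWithinAt) hD1 (convex_segment x y : Convex ℝ (segment ℝ x y))
      (right_mem_segment ℝ x y) (left_mem_segment ℝ x y)
    rwa [← dist_eq_norm, ← dist_eq_norm] at this
  -- `S` has full measure in `U`, so any Lipschitz extension from `S` is a representative.
  obtain ⟨w, hw, hwS⟩ := hS.extend_real
  refine ⟨w, hw, ?_⟩
  rw [Filter.EventuallyEq, ae_restrict_iff' hU.measurableSet]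
  filter_upwards [hae] with x hx hxU
  refine hwS ⟨hxU, ?_⟩
  rwa [indicator_of_mem hxU] at hx

theorem IsWeakGradient.weakGrad {U : Set Plane} {u : Plane → ℝ} {g : Plane → Plane}
    (h : IsWeakGradient U u g) : IsWeakGradient U u (weakGrad U u) := by
  have hex : ∃ g, IsWeakGradient U u g := ⟨g, h⟩
  rw [FEM.weakGrad, dif_pos hex]
  exact hex.choose_spec

/-! ### Inverse estimates for affine functions -/

/-- An affine function with values in `[-B, B]` on a disc of radius `r` has slope at most `B / r`. -/
theorem norm_affineGrad_le {a : Plane →ᴬ[ℝ] ℝ} {c : Plane} {r B : ℝ} (hr : 0 < r)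
    (h : ∀ x ∈ Metric.closedBall c r, |a x| ≤ B) : ‖affineGrad a‖ ≤ B / r := by
  have hB : 0 ≤ B := (abs_nonneg _).trans (h c (Metric.mem_closedBall_self hr.le))
  rw [norm_affineGrad]
  refine ContinuousLinearMap.opNorm_le_of_unit_norm (by positivity) fun e he => ?_
  -- The values at two antipodal points differ by `2 r` times the slope in direction `e`, and by at
  -- most `2 B`.
  have hp := abs_le.1 (h (c + r • e) (by simp [norm_smul, he, abs_of_pos hr]))
  have hm := abs_le.1 (h (c - r • e) (by simp [norm_smul, he, abs_of_pos hr]))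
  have hsub := a.contLinear_map_vsub (c + r • e) (c - r • e)
  simp only [vsub_eq_sub] at hsub
  rw [show c + r • e - (c - r • e) = (2 * r) • e by module, map_smul, smul_eq_mul] at hsub
  rw [Real.norm_eq_abs, le_div_iff₀ hr]
  calc |a.contLinear e| * r = |a.contLinear e * r| := by rw [abs_mul, abs_of_pos hr]
    _ ≤ B := abs_le.2 ⟨by linarith, by linarith⟩

theorem affineGrad_smul_add (m : ℝ) (a b : Plane →ᴬ[ℝ] ℝ) :
    affineGrad (m • a + b) = m • affineGrad a + affineGrad b := by
  simp [affineGrad]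

theorem lpNormOn_two_le {F : Type*} [NormedAddCommGroup F] {U : Set Plane}
    (hU : volume U ≠ ⊤) {f : Plane → F} {B : ℝ} (hB : 0 ≤ B)
    (h : ∀ᵐ x ∂volume.restrict U, ‖f x‖ ≤ B) :
    lpNormOn 2 U f ≤ B * √(volume.real U) := by
  have h1 := eLpNorm_le_of_ae_bound (p := 2) h
  rw [Measure.restrict_apply_univ] at h1
  have h2 := ENNReal.toReal_mono (by finiteness) h1
  rw [ENNReal.toReal_mul, ENNReal.toReal_ofReal hB, ← ENNReal.toReal_rpow] at h2
  rw [lpNormOn, mul_comm, Real.sqrt_eq_rpow]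
  simpa [Measure.real] using h2

/-- The maximum of an affine function on a convex set is controlled by its `L²` norm. -/
theorem mul_sqrt_le_lpNormOn {Q : Set Plane} (hQ : Convex ℝ Q)
    (hvol : volume (interior Q) ≠ ⊤) {a : Plane →ᴬ[ℝ] ℝ} {p : Plane} (hp : p ∈ Q)
    (hmax : ∀ x ∈ Q, |a x| ≤ |a p|) :
    |a p| * √(volume.real (interior Q)) ≤ 8 * lpNormOn 2 (interior Q) a := by
  -- On the copy of the interior shrunk by 1/4 towards `p`, `|a| ≥ 3/4 |a p| - 1/4 |a p| = |a p| /
  -- 2`. Its area is 1/16 of the original, whence the factor `8 = 2 * 4`.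
  set T := AffineMap.homothety p (1 / 4 : ℝ) '' interior Q with hT
  have hTo : IsOpen T := AffineMap.homothety_isOpenMap p _ (by norm_num) _ isOpen_interior
  have hTU : T ⊆ interior Q := by
    rintro _ ⟨x, hx, rfl⟩
    rw [AffineMap.homothety_apply]
    have := hQ.combo_self_interior_mem_interior hp hx (a := 3 / 4) (b := 1 / 4) (by norm_num)
      (by norm_num) (by norm_num)
    convert this using 1
    simp only [vsub_eq_sub, vadd_eq_add]
    module
  have hlow : ∀ x ∈ T, |a p| / 2 ≤ |a x| := by
    rintro _ ⟨x, hx, rfl⟩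
    have h1 := hmax x (interior_subset hx)
    have h2 : a (AffineMap.homothety p (1 / 4 : ℝ) x) = 3 / 4 * a p + 1 / 4 * a x := by
      rw [AffineMap.homothety_eq_lineMap, ContinuousAffineMap.apply_lineMap,
        AffineMap.lineMap_apply]
      simp only [vsub_eq_sub, vadd_eq_add, smul_eq_mul]
      ring
    rw [h2]
    have h3 := abs_sub_abs_le_abs_sub (3 / 4 * a p) (-(1 / 4 * a x))
    rw [sub_neg_eq_add, abs_neg, abs_mul, abs_mul] at h3
    norm_num at h3 ⊢
    linarith [abs_nonneg (a p)]
  have hle : eLpNorm (fun _ : Plane => |a p| / 2) 2 (volume.restrict T)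
      ≤ eLpNorm a 2 (volume.restrict (interior Q)) := by
    refine (eLpNorm_mono_ae ?_).trans (eLpNorm_mono_measure _ (Measure.restrict_mono hTU le_rfl))
    refine ae_restrict_of_forall_mem hTo.measurableSet fun x hx => ?_
    rw [Real.norm_of_nonneg (by positivity), Real.norm_eq_abs]
    exact hlow x hx
  have hfin : eLpNorm a 2 (volume.restrict (interior Q)) ≠ ⊤ := by
    have := eLpNorm_le_of_ae_bound (p := 2) (μ := volume.restrict (interior Q)) (f := a)
      (C := |a p|) (ae_restrict_of_forall_mem isOpen_interior.measurableSet fun x hx =>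
        hmax x (interior_subset hx))
    rw [Measure.restrict_apply_univ] at this
    exact ne_top_of_le_ne_top (by finiteness) this
  have h3 := ENNReal.toReal_mono hfin hle
  rw [eLpNorm_const' _ (by norm_num) (by norm_num), Measure.restrict_apply_univ, hT,
    Measure.addHaar_image_homothety, ENNReal.toReal_mul, ← ENNReal.toReal_rpow,
    ENNReal.toReal_mul, ENNReal.toReal_ofReal (by positivity), toReal_enorm,
    Real.norm_of_nonneg (by positivity), finrank_euclideanSpace_fin] at h3
  have h4 : ((|(1 / 4 : ℝ) ^ 2| * (volume (interior Q)).toReal) ^ (1 / (2 : ℝ≥0∞).toReal) : ℝ)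
      = 1 / 4 * √(volume.real (interior Q)) := by
    rw [ENNReal.toReal_ofNat, ← Real.sqrt_eq_rpow, abs_of_nonneg (by positivity),
      Real.sqrt_mul (by positivity), Real.sqrt_sq (by norm_num), Measure.real]
  rw [h4] at h3
  rw [lpNormOn]
  linarith

/-! ### The estimate on a single triangle -/

section Triangle

variable (K : Affine.Triangle ℝ Plane)

theorem coord_nonneg {x : Plane} (hx : x ∈ K.closedInterior) (i : Fin 3) :
    0 ≤ (triangleBasis K).coord i x := by
  rw [← K.convexHull_eq_closedInterior] at hx
  have h := (triangleBasis K).convexHull_eq_nonneg_coord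
  have h' : convexHull ℝ (range K.points) = {x | ∀ i, 0 ≤ (triangleBasis K).coord i x} := h
  rw [h'] at hx
  exact hx i

/-- The Lagrange interpolant with nodal values `c`. -/
noncomputable def nodalAffine (c : Fin 3 → ℝ) : Plane →ᴬ[ℝ] ℝ :=
  let l (i : Fin 3) : Plane →ᴬ[ℝ] ℝ :=
    ⟨(triangleBasis K).coord i, AffineMap.continuous_of_finiteDimensional _⟩
  c 0 • l 0 + c 1 • l 1 + c 2 • l 2

theorem nodalAffine_apply (c : Fin 3 → ℝ) (x : Plane) :
    nodalAffine K c x = ∑ i, c i * (triangleBasis K).coord i x := by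
  rw [Fin.sum_univ_three]
  rfl

/-- Affine maps commute with affine combinations; this is the exactness of nodal interpolation on
affine functions. -/
theorem affine_eq_sum_coord (a : Plane →ᴬ[ℝ] ℝ) (x : Plane) :
    a x = ∑ i, a (K.points i) * (triangleBasis K).coord i x := by
  have h1 := (triangleBasis K).affineCombination_coord_eq_self x
  have hs := (triangleBasis K).sum_coord_apply_eq_one x
  have h2 := Finset.univ.map_affineCombination (triangleBasis K)
    (fun i => (triangleBasis K).coord i x) hs (a : Plane →ᵃ[ℝ] ℝ)
  rw [h1, Finset.affineCombination_eq_linear_combination _ _ _ hs] at h2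
  refine h2.trans (Finset.sum_congr rfl fun i _ => ?_)
  rw [smul_eq_mul, mul_comm]
  rfl

/-- On the triangle the barycentric coordinates are the weights of a convex combination of the nodal
values. -/
theorem abs_nodalAffine_le {c : Fin 3 → ℝ} {B : ℝ} (hc : ∀ i, |c i| ≤ B) {x : Plane}
    (hx : x ∈ K.closedInterior) : |nodalAffine K c x| ≤ B := by
  rw [nodalAffine_apply]
  calc |∑ i, c i * (triangleBasis K).coord i x|
      ≤ ∑ i, |c i * (triangleBasis K).coord i x| := Finset.abs_sum_le_sum_abs _ _
    _ ≤ ∑ i, B * (triangleBasis K).coord i x := by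
        refine Finset.sum_le_sum fun i _ => ?_
        rw [abs_mul, abs_of_nonneg (coord_nonneg K hx i)]
        exact mul_le_mul_of_nonneg_right (hc i) (coord_nonneg K hx i)
    _ = B := by rw [← Finset.mul_sum, (triangleBasis K).sum_coord_apply_eq_one, mul_one]

theorem convex_closedInterior : Convex ℝ K.closedInterior := by
  rw [← K.convexHull_eq_closedInterior]
  exact convex_convexHull ℝ _

theorem volume_interior_ne_top : volume (interior K.closedInterior) ≠ ⊤ :=
  ne_top_of_le_ne_top K.isCompact_closedInterior.measure_lt_top.ne (measure_mono interior_subset)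

/-- A function in `W^{1,∞}(K)` is Lipschitz continuous with its seminorm as constant. -/
theorem MemW1.exists_lipschitzWith {φ : Plane → ℝ} (hφ : MemW1 ∞ (interior K.closedInterior) φ) :
    (∀ᵐ x ∂volume.restrict (interior K.closedInterior),
      ‖weakGrad (interior K.closedInterior) φ x‖ ≤ seminormW1Infty (interior K.closedInterior) φ) ∧
    ∃ w : Plane → ℝ,
      LipschitzWith (seminormW1Infty (interior K.closedInterior) φ).toNNReal w ∧
        φ =ᵐ[volume.restrict (interior K.closedInterior)] w := by
  set U := interior K.closedInterior
  have hU : IsOpen U := isOpen_interior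
  have : IsFiniteMeasure (volume.restrict U) :=
    isFiniteMeasure_restrict.2 (volume_interior_ne_top K)
  obtain ⟨hφ1, g, hg, hg'⟩ := hφ
  have hw := hg.weakGrad
  have hmem : MemLp (weakGrad U φ) ∞ (volume.restrict U) := (memLp_congr_ae (hg.ae_eq hU hw)).1 hg'
  have hbound : ∀ᵐ x ∂volume.restrict U, ‖weakGrad U φ x‖ ≤ seminormW1Infty U φ := by
    filter_upwards [ae_le_eLpNormEssSup (f := weakGrad U φ) (μ := volume.restrict U)] with x hx
    have := ENNReal.toReal_mono (by simpa using hmem.eLpNorm_ne_top) hx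
    rw [toReal_enorm] at this
    simpa [seminormW1Infty, lpNormOn] using this
  refine ⟨hbound, hw.exists_lipschitzWith hU (convex_closedInterior K).interior ?_ ?_⟩
  · have h1 : IntegrableOn φ U volume := hφ1.integrable (by simp)
    exact (h1.integrable_indicator hU.measurableSet).locallyIntegrable
  · filter_upwards [hbound] with x hx
    exact hx.trans (Real.le_coe_toNNReal _)

/-- The interpolation error on a single triangle. -/
theorem interpolation_error_estimate {σ : ℝ} {c : Plane} {r : ℝ} (hr : 0 < r)
    (hball : Metric.closedBall c r ⊆ K.closedInterior)
    (hσ : Metric.diam K.closedInterior ≤ σ * (2 * r))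
    {v : Plane → ℝ} {a : Plane →ᴬ[ℝ] ℝ} (hva : EqOn v a K.closedInterior)
    {φ φc : Plane → ℝ} {g : Plane → Plane} {L : ℝ} (hL : 0 ≤ L)
    (hg : IsWeakGradient (interior K.closedInterior) φ g)
    (hgL : ∀ᵐ x ∂volume.restrict (interior K.closedInterior), ‖g x‖ ≤ L)
    (hlip : ∀ x y, |φc x - φc y| ≤ L * dist x y)
    (hφ : φ =ᵐ[volume.restrict (interior K.closedInterior)] φc) :
    let U := interior K.closedInterior
    let e := fun x => v x * φc x - lagrangeInterp K (fun y => v y * φc y) x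
    MemW1 2 U e ∧
      lpNormOn 2 U e ≤ 16 * Metric.diam K.closedInterior * L * lpNormOn 2 U v ∧
      lpNormOn 2 U (weakGrad U e) ≤ (8 + 32 * σ) * L * lpNormOn 2 U v := by
  intro U e
  have hU : IsOpen U := isOpen_interior
  have hfin : volume U ≠ ⊤ := volume_interior_ne_top K
  have : IsFiniteMeasure (volume.restrict U) := isFiniteMeasure_restrict.2 hfin
  set d := Metric.diam K.closedInterior with hd
  have hd0 : 0 ≤ d := Metric.diam_nonneg
  have hdist : ∀ x ∈ K.closedInterior, ∀ y ∈ K.closedInterior, dist x y ≤ d := fun x hx y hy =>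
    Metric.dist_le_diam_of_mem K.isCompact_closedInterior.isBounded hx hy
  obtain ⟨p, hp, hmax⟩ := K.isCompact_closedInterior.exists_isMaxOn K.nonempty_closedInterior
    a.continuous.abs.continuousOn
  set M := |a p| with hM
  have hmax' : ∀ x ∈ K.closedInterior, |a x| ≤ M := hmax
  have hM0 : 0 ≤ M := abs_nonneg _
  have hvnorm : lpNormOn 2 U v = lpNormOn 2 U a := by
    rw [lpNormOn, lpNormOn, eLpNorm_congr_ae]
    exact ae_restrict_of_forall_mem hU.measurableSet fun x hx => hva (interior_subset hx)
  have hMv : M * √(volume.real U) ≤ 8 * lpNormOn 2 U v := by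
    rw [hvnorm]
    exact mul_sqrt_le_lpNormOn (convex_closedInterior K) hfin hp hmax'
  -- Any value of `φc` on the triangle would serve; only `|φc - m| ≤ L d` matters.
  set m := φc (K.points 0) with hm
  have hψ : ∀ x ∈ K.closedInterior, |φc x - m| ≤ L * d := fun x hx =>
    (hlip _ _).trans (mul_le_mul_of_nonneg_left
      (hdist _ hx _ (K.point_mem_closedInterior 0)) hL)
  let b : Plane →ᴬ[ℝ] ℝ := nodalAffine K fun i => a (K.points i) * (φc (K.points i) - m)
  have hb : ∀ x ∈ K.closedInterior, |b x| ≤ M * (L * d) := fun x hx =>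
    abs_nodalAffine_le K (fun i => by
      rw [abs_mul]
      exact mul_le_mul (hmax' _ (K.point_mem_closedInterior i))
        (hψ _ (K.point_mem_closedInterior i)) (abs_nonneg _) hM0) hx
  have hinterp : ∀ x, lagrangeInterp K (fun y => v y * φc y) x = m * a x + b x := fun x => by
    rw [affine_eq_sum_coord K a x, nodalAffine_apply, Finset.mul_sum, ← Finset.sum_add_distrib]
    refine Finset.sum_congr rfl fun i _ => ?_
    beta_reduce
    rw [hva (K.point_mem_closedInterior i)]
    ring
  have he : ∀ x ∈ K.closedInterior, e x = a x * (φc x - m) - b x := fun x hx => by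
    simp only [e, hinterp, hva hx]
    ring
  have hebound : ∀ᵐ x ∂volume.restrict U, ‖e x‖ ≤ 2 * (M * (L * d)) :=
    ae_restrict_of_forall_mem hU.measurableSet fun x hx => by
      have hx' := interior_subset hx
      rw [he x hx', Real.norm_eq_abs]
      refine (abs_sub _ _).trans ?_
      rw [abs_mul]
      have := mul_le_mul (hmax' x hx') (hψ x hx') (abs_nonneg _) hM0
      linarith [hb x hx']
  -- `ℓ` is the interpolant itself. It is treated as `ℓ` times the constant 1, so `G` has exactly
  -- the form that the product rule and `IsWeakGradient.sub` deliver.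
  let ℓ : Plane →ᴬ[ℝ] ℝ := m • a + b
  let G : Plane → Plane := fun x => (a x • g x + φ x • affineGrad a)
    - (ℓ x • (0 : Plane) + (1 : ℝ) • affineGrad ℓ)
  have hG : IsWeakGradient U e G := by
    refine ((hg.affine_mul hU a).sub ((isWeakGradient_one U).affine_mul hU ℓ)).congr_ae hU ?_
    filter_upwards [hφ, ae_restrict_mem hU.measurableSet] with x hx hxU
    rw [he x (interior_subset hxU), hx]
    simp only [ℓ, ContinuousAffineMap.add_apply, ContinuousAffineMap.smul_apply, smul_eq_mul]
    ring
  have hGe : weakGrad U e =ᵐ[volume.restrict U] G := hG.weakGrad.ae_eq hU hG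
  -- The factor `d`, supplied later by `|φc - m| ≤ L d`, compensates the `1 / r` of the inverse
  -- estimate.
  have hga : d * ‖affineGrad a‖ ≤ 2 * σ * M := by
    have h1 := norm_affineGrad_le hr fun x hx => hmax' x (hball hx)
    calc d * ‖affineGrad a‖ ≤ (σ * (2 * r)) * (M / r) :=
          mul_le_mul hσ h1 (norm_nonneg _) (hd0.trans hσ)
      _ = 2 * σ * M := by field_simp
  have hgb : ‖affineGrad b‖ ≤ 2 * σ * M * L := by
    refine (norm_affineGrad_le hr fun x hx => hb x (hball hx)).trans ?_
    rw [div_le_iff₀ hr]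
    calc M * (L * d) ≤ M * (L * (σ * (2 * r))) := by gcongr
      _ = 2 * σ * M * L * r := by ring
  have hσ0 : 0 ≤ σ := by
    by_contra hneg
    nlinarith
  have hGbound : ∀ᵐ x ∂volume.restrict U, ‖weakGrad U e x‖ ≤ (1 + 4 * σ) * (M * L) := by
    filter_upwards [hGe, hφ, hgL, ae_restrict_mem hU.measurableSet] with x hx hφx hgx hxU
    have hxK := interior_subset hxU
    have hGx : G x = a x • g x + (φc x - m) • affineGrad a - affineGrad b := by
      simp only [G, ℓ, affineGrad_smul_add, hφx]
      module
    rw [hx, hGx]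
    have h1 : ‖a x • g x‖ ≤ M * L := by
      rw [norm_smul]
      exact mul_le_mul (hmax' x hxK) hgx (norm_nonneg _) hM0
    have h2 : ‖(φc x - m) • affineGrad a‖ ≤ L * (2 * σ * M) := by
      rw [norm_smul]
      calc |φc x - m| * ‖affineGrad a‖ ≤ L * d * ‖affineGrad a‖ := by
            gcongr
            exact hψ x hxK
        _ = L * (d * ‖affineGrad a‖) := by ring
        _ ≤ L * (2 * σ * M) := by gcongr
    have h3 := (norm_sub_le (a x • g x + (φc x - m) • affineGrad a) (affineGrad b)).trans
      (add_le_add_left (norm_add_le _ _) _)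
    linarith
  refine ⟨⟨?_, _, hG.weakGrad, ?_⟩, ?_, ?_⟩
  · exact MemLp.of_bound hG.locallyIntegrableOn.aestronglyMeasurable _ hebound
  · exact MemLp.of_bound hG.weakGrad.locallyIntegrableOn_grad.aestronglyMeasurable _ hGbound
  · refine (lpNormOn_two_le hfin (by positivity) hebound).trans ?_
    calc 2 * (M * (L * d)) * √(volume.real U) = 2 * L * d * (M * √(volume.real U)) := by ring
      _ ≤ 2 * L * d * (8 * lpNormOn 2 U v) := by gcongr
      _ = 16 * d * L * lpNormOn 2 U v := by ring
  · refine (lpNormOn_two_le hfin (by positivity) hGbound).trans ?_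
    calc (1 + 4 * σ) * (M * L) * √(volume.real U)
        = (1 + 4 * σ) * L * (M * √(volume.real U)) := by ring
      _ ≤ (1 + 4 * σ) * L * (8 * lpNormOn 2 U v) := by gcongr
      _ = (8 + 32 * σ) * L * lpNormOn 2 U v := by ring

end Triangle

end FEM

/-! ### The main theorem -/

theorem mainTheorem3 (σ : ℝ) :
    ∃ C : ℝ, 0 < C ∧
      ∀ (Ω : Set FEM.Plane) (T : FEM.TriMesh Ω), T.IsShapeRegular σ →
      ∀ v : FEM.Plane → ℝ, T.MemP1 v →
      ∀ K ∈ T.elems,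
      ∀ φ : FEM.Plane → ℝ, FEM.MemW1 ∞ (interior K.closedInterior) φ →
        -- the continuous representative of `φ` on the closed triangle
        ∃ φc : FEM.Plane → ℝ, ContinuousOn φc K.closedInterior ∧
          φ =ᵐ[volume.restrict (interior K.closedInterior)] φc ∧
          -- the interpolation error is in `H¹(K)`, and the estimate holds
          FEM.MemW1 2 (interior K.closedInterior)
            (fun x => v x * φc x - FEM.lagrangeInterp K (fun y => v y * φc y) x) ∧
          FEM.lpNormOn 2 (interior K.closedInterior)
              (fun x => v x * φc x - FEM.lagrangeInterp K (fun y => v y * φc y) x)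
            + T.meshSize * FEM.lpNormOn 2 (interior K.closedInterior)
                (FEM.weakGrad (interior K.closedInterior)
                  (fun x => v x * φc x - FEM.lagrangeInterp K (fun y => v y * φc y) x))
          ≤ C * T.meshSize * FEM.seminormW1Infty (interior K.closedInterior) φ
              * FEM.lpNormOn 2 (interior K.closedInterior) v := by
  -- The constant is 16 from the function plus `8 + 32 |σ|` from the gradient; the absolute value
  -- makes it positive for every real `σ`.
  refine ⟨24 + 32 * |σ|, by positivity, fun Ω T hT v hv K hK φ hφ => ?_⟩
  obtain ⟨c, r, hr, hball, hdiam⟩ := hT K hK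
  obtain ⟨a, ha⟩ := hv.2 K hK
  obtain ⟨hgL, φc, hlip, hae⟩ := hφ.exists_lipschitzWith K
  set U := interior K.closedInterior
  set L := FEM.seminormW1Infty U φ
  have hL : 0 ≤ L := ENNReal.toReal_nonneg
  have hlip' : ∀ x y, |φc x - φc y| ≤ L * dist x y := fun x y => by
    have := hlip.dist_le_mul x y
    rwa [Real.dist_eq, Real.coe_toNNReal _ hL] at this
  obtain ⟨_, g, hg, -⟩ := id hφ
  obtain ⟨hmem, h0, h1⟩ := FEM.interpolation_error_estimate K hr hball hdiam ha hL hg.weakGrad hgL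
    hlip' hae
  refine ⟨φc, hlip.continuous.continuousOn, hae, hmem, ?_⟩
  have hh : Metric.diam K.closedInterior ≤ T.meshSize :=
    le_ciSup (f := fun K : T.elems => Metric.diam (K : Affine.Triangle ℝ FEM.Plane).closedInterior)
      (finite_range _).bddAbove ⟨K, hK⟩
  have hh0 : 0 ≤ T.meshSize := Metric.diam_nonneg.trans hh
  have hN : 0 ≤ FEM.lpNormOn 2 U v := ENNReal.toReal_nonneg
  calc _ ≤ 16 * Metric.diam K.closedInterior * L * FEM.lpNormOn 2 U v
        + T.meshSize * ((8 + 32 * σ) * L * FEM.lpNormOn 2 U v) := by gcongr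
    _ ≤ 16 * T.meshSize * L * FEM.lpNormOn 2 U v
        + T.meshSize * ((8 + 32 * |σ|) * L * FEM.lpNormOn 2 U v) := by
      gcongr
      exact le_abs_self σ
    _ = (24 + 32 * |σ|) * T.meshSize * L * FEM.lpNormOn 2 U v := by ring
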